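/- **Categories of chains and hall forests.** Let $\mathsf{MC}$ be the category whose objects are finite multisets $C=\{C_1,\dots,C_m\}$ ($m\ge 0$) of nonempty finite chains. A morphism $\{C_1,\dots,C_m\}\to\{D_1,\dots,D_n\}$ is a family $(h_i)_{i=1}^m$ in which each $h_i\colon C_i\twoheadrightarrow D_{j}$ is an order-preserving surjection onto some member $D_j$, $j=j(i)\in\{1,\dots,n\}$; the index $j(i)$ of the target is part of the morphism. Let $\mathsf{MC}^\top$ be the (nonfull) subcategory of $\mathsf{MC}$ with the same objects, whose morphisms are those for which, for every $i$, if the target $D_j$ of $h_i$ is not a one-element chain, then $h_i^{-1}(\max D_j)=\{\max C_i\}$. Let $\mathsf{HF}$ be the category of finite hall forests. Its objects are the finite multisets $\{(T_i,J_i)\}_{i\in I}$, where each $T_i$ is a finite tree (a finite poset with minimum in which the downset of each element is a chain) and each $J_i$ is a possibly empty finite chain. A morphism $\{(T_i,J_i)\}_{i\in I}\to\{(T'_k,J'_k)\}_{k\in K}$ is a family of pairs $\{(f_i,g_i)\}_{i\in I}$ such that for each $i$ there is $k=k(i)\in K$ (again part of the morphism) for which $f_i\colon T_i\to T'_k$ is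 order-preserving and maps downsets onto downsets, and: if $J'_k=\emptyset$, then $g_i$ is the nowhere defined partial map from $J_i$ to $J'_k$; if $J'_k\neq\emptyset$, then $J_i\ne\emptyset$ and $g_i\colon J_i\to J'_k$ is an order-preserving map that maps downsets onto downsets and satisfies $g_i(\max J_i)=\max J'_k$. **DP-algebras.** An MTL-algebra is a prelinear, commutative, bounded, integral residuated lattice $(A,*,\Rightarrow,\sqcap,\sqcup,0,1)$. A drastic product chain is a totally ordered MTL-algebra in which $x*y=0$ if $x,y<1$ and $x*y=\min\{x,y\}$ otherwise. DP-algebras are the members of the subvariety of MTL-algebras generated by all drastic product chains, that is, the MTL-algebras satisfying all equations that hold in every drastic product chain. Homomorphisms preserve $*,\Rightarrow,\sqcap,\sqcup,0,1$. **Theorem.** The category $\mathsf{MC}^\top$ is equivalent to the full subcategory of $\mathsf{HF}$ whose objects have the form $\{(\mathbf 1,J_i)\}_{i\in I}$, where $\mathbf 1$ is the one-element tree. Moreover, $\mathsf{MC}^\top$ is dually equivalent to the category of finite DP-algebras and their homomorphisms. -/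

import Mathlib

open CategoryTheory

universe u

/-! ### Finite multisets of finite chains -/

/-- A finite multiset of nonempty finite chains, displayed as a family `{C i}` indexed by a
finite type (repetitions are allowed, the index set may be empty). -/
structure MC : Type (u + 1) where
  ι : Type u
  [finite : Finite ι]
  chain : ι → NonemptyFinLinOrd.{u}

attribute [instance] MC.finite

/-- A morphism `C ⟶ D` of multisets of chains: for every member `C i` of `C`, a member
`D (idx i)` of `D` and an order-preserving surjection `C i ↠ D (idx i)`. -/
@[ext]
structure MC.Hom (C D : MC.{u}) : Type u where
  idx : C.ι → D.ι
  map : ∀ i, C.chain i →o D.chain (idx i)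
  surj : ∀ i, Function.Surjective (map i)

instance MC.category : Category.{u} MC.{u} where
  Hom := MC.Hom
  id C := ⟨id, fun _ => OrderHom.id, fun _ => Function.surjective_id⟩
  comp f g := ⟨g.idx ∘ f.idx, fun i => (g.map (f.idx i)).comp (f.map i),
    fun i => (g.surj (f.idx i)).comp (f.surj i)⟩

/-- The constraint cutting out the nonfull subcategory: whenever the target `D j` (`j = idx i`) of
the component `h i : C i ↠ D j` is not a one-element chain, `h i ⁻¹ (max D j) = {max C i}`. -/
def MC.topProp : MorphismProperty MC.{u} := fun C D (h : MC.Hom C D) =>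
  ∀ i, Nontrivial (D.chain (h.idx i)) →
    (h.map i) ⁻¹' {(⊤ : D.chain (h.idx i))} = {(⊤ : C.chain i)}

instance MC.topProp_isMultiplicative : MC.topProp.{u}.IsMultiplicative where
  id_mem _ := fun _ _ => rfl
  comp_mem {C D E} f g hf hg := by
    intro i hE
    have h1 := hg (f.idx i) hE
    have hD : Nontrivial (D.chain (f.idx i)) := 
      @Function.Surjective.nontrivial _ _ hE _ (g.surj (f.idx i))
    have h2 := hf i hD
    calc _ = (f.map i) ⁻¹' ((g.map (f.idx i)) ⁻¹' {⊤}) := rfl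
      _ = _ := by rw [h1, h2]

/-- The category `MC^⊤`: all finite multisets of nonempty finite chains, with those morphisms that
satisfy the constraint on tops. -/
abbrev MCTop : Type (u + 1) := WideSubcategory MC.topProp.{u}

/-! ### Finite hall forests -/

/-- A pair `(T, J)` of a finite tree `T` (a finite poset with minimum in which the downset of each
element is a chain) and a possibly empty finite chain `J`. -/
structure HallPair : Type (u + 1) where
  T : Type u
  [partialOrderT : PartialOrder T]
  [finiteT : Finite T]
  exists_min : ∃ m : T, ∀ x, m ≤ x
  downset_chain : ∀ x : T, IsChain (· ≤ ·) (Set.Iic x)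
  J : Type u
  [linearOrderJ : LinearOrder J]
  [finiteJ : Finite J]

attribute [instance] HallPair.partialOrderT HallPair.finiteT HallPair.linearOrderJ
  HallPair.finiteJ

/-- Order-preserving maps sending downsets onto downsets. -/
structure IsTreeMap {S T : Type u} [PartialOrder S] [PartialOrder T] (f : S → T) : Prop where
  monotone : Monotone f
  image_lower : ∀ A : Set S, IsLowerSet A → IsLowerSet (f '' A)

/-- The admissible maps between the chains of two pairs; a partial map from `J` to `K` is written as
a map `J → Option K`, with value `none` where it is undefined. If `K` is empty, `g` is the partial,
nowhere defined, map. If `K` is nonempty, `g` is a total order-preserving and downset preserving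
map, and it satisfies `g (max J) = max K` (in particular `J` has a maximum, so it is nonempty). -/
structure IsChainMap {J K : Type u} [LinearOrder J] [LinearOrder K] (g : J → Option K) : Prop where
  total : Nonempty K → ∀ x, ∃ a, g x = some a
  monotone : ∀ x y a b, x ≤ y → g x = some a → g y = some b → a ≤ b
  image_lower : ∀ A : Set J, IsLowerSet A → IsLowerSet {a : K | ∃ x ∈ A, g x = some a}
  map_max : Nonempty K → ∃ m n, IsTop m ∧ IsTop n ∧ g m = some n

theorem IsTreeMap.comp {R S T : Type u} [PartialOrder R] [PartialOrder S] [PartialOrder T]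
    {g : S → T} {f : R → S} (hg : IsTreeMap g) (hf : IsTreeMap f) : IsTreeMap (g ∘ f) where
  monotone := hg.monotone.comp hf.monotone
  image_lower A hA := by
    rw [Set.image_comp]
    exact hg.image_lower _ (hf.image_lower A hA)

theorem IsTreeMap.id {S : Type u} [PartialOrder S] : IsTreeMap (id : S → S) where
  monotone := monotone_id
  image_lower A hA := by simpa using hA

theorem IsChainMap.id {J : Type u} [LinearOrder J] [Finite J] :
    IsChainMap (some : J → Option J) where
  total _ x := ⟨x, rfl⟩
  monotone x y a b h ha hb := by
    obtain rfl := Option.some.inj ha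
    obtain rfl := Option.some.inj hb
    exact h
  image_lower A hA := by simpa using hA
  map_max _ := by
    obtain ⟨m, hm⟩ := Finite.exists_max (_root_.id : J → J)
    exact ⟨m, m, hm, hm, rfl⟩

theorem IsChainMap.comp {J K L : Type u} [LinearOrder J] [LinearOrder K] [LinearOrder L]
    {g : K → Option L} {f : J → Option K} (hg : IsChainMap g) (hf : IsChainMap f) :
    IsChainMap (fun x => (f x).bind g) where
  total hL x := by
    obtain ⟨m, -, -, -, -⟩ := hg.map_max hL
    obtain ⟨a, ha⟩ := hf.total ⟨m⟩ x
    simpa [ha] using hg.total hL a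
  monotone x y a b h ha hb := by
    obtain ⟨a', ha', ha⟩ := Option.bind_eq_some_iff.1 ha
    obtain ⟨b', hb', hb⟩ := Option.bind_eq_some_iff.1 hb
    exact hg.monotone _ _ _ _ (hf.monotone _ _ _ _ h ha' hb') ha hb
  image_lower A hA := by
    have := hg.image_lower _ (hf.image_lower A hA)
    convert this using 1
    ext y
    simp only [Set.mem_ofPred_eq, Option.bind_eq_some_iff]
    constructor
    · rintro ⟨x, hx, z, hz, hy⟩
      exact ⟨z, ⟨x, hx, hz⟩, hy⟩
    · rintro ⟨z, ⟨x, hx, hz⟩, hy⟩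
      exact ⟨x, hx, z, hz, hy⟩
  map_max hL := by
    obtain ⟨m, n, hm, hn, hmn⟩ := hg.map_max hL
    obtain ⟨p, q, hp, hq, hpq⟩ := hf.map_max ⟨m⟩
    obtain rfl : q = m := le_antisymm (hm q) (hq m)
    exact ⟨p, n, hp, hn, by simp [hpq, hmn]⟩

/-- A finite hall forest: a finite multiset of pairs `(T, J)`, displayed as a family indexed by a
finite type. -/
structure HF : Type (u + 1) where
  ι : Type u
  [finite : Finite ι]
  pair : ι → HallPair.{u}

attribute [instance] HF.finite

/-- A morphism of finite hall forests: for every index `i` of the source an index `k = idx i` of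
the target, and a pair of maps `T i → T k`, `J i → J k` as above. -/
@[ext]
structure HF.Hom (X Y : HF.{u}) : Type u where
  idx : X.ι → Y.ι
  tree : ∀ i, (X.pair i).T → (Y.pair (idx i)).T
  chain : ∀ i, (X.pair i).J → Option (Y.pair (idx i)).J
  isTreeMap : ∀ i, IsTreeMap (tree i)
  isChainMap : ∀ i, IsChainMap (chain i)

instance HF.category : Category.{u} HF.{u} where
  Hom := HF.Hom
  id _ := ⟨id, fun _ => id, fun _ => some, fun _ => IsTreeMap.id, fun _ => IsChainMap.id⟩
  comp f g := ⟨g.idx ∘ f.idx, fun i => g.tree (f.idx i) ∘ f.tree i,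
    fun i x => (f.chain i x).bind (g.chain (f.idx i)),
    fun i => (g.isTreeMap (f.idx i)).comp (f.isTreeMap i),
    fun i => (g.isChainMap (f.idx i)).comp (f.isChainMap i)⟩
  id_comp _ := HF.Hom.ext rfl HEq.rfl HEq.rfl
  comp_id f := HF.Hom.ext rfl HEq.rfl
    (heq_of_eq (funext fun i => funext fun x => Option.bind_fun_some (f.chain i x)))
  assoc f _ _ := HF.Hom.ext rfl HEq.rfl
    (heq_of_eq (funext fun i => funext fun x => Option.bind_assoc (f.chain i x) _ _))

/-- The hall forests of the form `{(𝟏, J i)}`: all trees have exactly one element (trees are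
nonempty by definition). -/
def HF.trivialTrees : ObjectProperty HF.{u} := fun X => ∀ i, Subsingleton (X.pair i).T

/-! ### Finite drastic product algebras -/

/-- MTL-algebras `(A, *, ⇨, ⊓, ⊔, ⊥, 1)`: prelinear, commutative, bounded, integral residuated
lattices. The symbol `⇨` is only a notation for the residuum of `*`. -/
class MTLAlgebra (A : Type u) extends Lattice A, BoundedOrder A, CommMonoid A, HImp A where
  one_eq_top : (1 : A) = ⊤
  residuation : ∀ x y z : A, x * y ≤ z ↔ x ≤ y ⇨ z
  prelinear : ∀ x y : A, (x ⇨ y) ⊔ (y ⇨ x) = 1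

/-- Homomorphisms of MTL-algebras: maps that preserve all operations. -/
@[ext]
structure MTLHom (A B : Type u) [MTLAlgebra A] [MTLAlgebra B] : Type u where
  toFun : A → B
  map_mul : ∀ x y, toFun (x * y) = toFun x * toFun y
  map_himp : ∀ x y, toFun (x ⇨ y) = toFun x ⇨ toFun y
  map_inf : ∀ x y, toFun (x ⊓ y) = toFun x ⊓ toFun y
  map_sup : ∀ x y, toFun (x ⊔ y) = toFun x ⊔ toFun y
  map_bot : toFun ⊥ = ⊥
  map_one : toFun 1 = 1

/-- Drastic product chains: totally ordered MTL-algebras in which `x * y` is `0` if `x, y < 1`, and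
`min {x, y}` otherwise. -/
structure IsDPChain (A : Type u) [MTLAlgebra A] : Prop where
  total : ∀ x y : A, x ≤ y ∨ y ≤ x
  mul_eq_bot : ∀ x y : A, x < 1 → y < 1 → x * y = ⊥
  mul_eq_inf : ∀ x y : A, ¬ (x < 1 ∧ y < 1) → x * y = x ⊓ y

/-- Terms over the signature of MTL-algebras in the variables `x₀, x₁, …`. -/
inductive MTLTerm : Type
  | var : ℕ → MTLTerm
  | zero : MTLTerm
  | one : MTLTerm
  | mul : MTLTerm → MTLTerm → MTLTerm
  | imp : MTLTerm → MTLTerm → MTLTerm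
  | inf : MTLTerm → MTLTerm → MTLTerm
  | sup : MTLTerm → MTLTerm → MTLTerm

/-- The value of a term in an MTL-algebra under an assignment of the variables. -/
def MTLTerm.eval {A : Type u} [MTLAlgebra A] (v : ℕ → A) : MTLTerm → A
  | var n => v n
  | zero => ⊥
  | one => 1
  | mul s t => s.eval v * t.eval v
  | imp s t => s.eval v ⇨ t.eval v
  | inf s t => s.eval v ⊓ t.eval v
  | sup s t => s.eval v ⊔ t.eval v

/-- The equation `s ≈ t` holds identically in `A`. -/
def SatisfiesEq (A : Type u) [MTLAlgebra A] (s t : MTLTerm) : Prop :=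
  ∀ v : ℕ → A, s.eval v = t.eval v

/-- Drastic product algebras: the members of the subvariety of MTL-algebras generated by all drastic
product chains, i.e. the MTL-algebras that satisfy every equation valid in all drastic product
chains. -/
def IsDPAlgebra (A : Type u) [MTLAlgebra A] : Prop :=
  ∀ s t : MTLTerm,
    (∀ (B : Type u) [MTLAlgebra B], IsDPChain B → SatisfiesEq B s t) → SatisfiesEq A s t

/-- Finite DP-algebras. -/
structure FinDP : Type (u + 1) where
  carrier : Type u
  [mtl : MTLAlgebra carrier]
  [finite : Finite carrier]
  isDP : IsDPAlgebra carrier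

attribute [instance] FinDP.mtl FinDP.finite

/-- The category of finite DP-algebras and their homomorphisms. -/
instance FinDP.category : Category.{u} FinDP.{u} where
  Hom A B := MTLHom A.carrier B.carrier
  id A := ⟨id, fun _ _ => rfl, fun _ _ => rfl, fun _ _ => rfl, fun _ _ => rfl, rfl, rfl⟩
  comp f g :=
    { toFun := g.toFun ∘ f.toFun
      map_mul := fun x y => by simp [f.map_mul, g.map_mul]
      map_himp := fun x y => by simp [f.map_himp, g.map_himp]
      map_inf := fun x y => by simp [f.map_inf, g.map_inf]
      map_sup := fun x y => by simp [f.map_sup, g.map_sup]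
      map_bot := by simp [f.map_bot, g.map_bot]
      map_one := by simp [f.map_one, g.map_one] }

theorem MC.topProp_iff {C D : MC.{u}} (h : MC.Hom C D) : MC.topProp h ↔
    ∀ i, Nontrivial (D.chain (h.idx i)) → ∀ x, IsTop (h.map i x) → IsTop x := by
  refine forall_congr' fun i => forall_congr' fun _ => ?_
  simp only [isTop_iff_eq_top]
  constructor
  · intro H x hx
    exact H.subset hx
  · intro H
    refine Set.Subset.antisymm (fun x hx => H x hx) ?_
    rintro _ rfl
    obtain ⟨x, hx⟩ := h.surj i ⊤
    exact top_unique (hx ▸ (h.map i).monotone le_top)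

/-- The total map `J ∪ {⊤} → K ∪ {⊤}` extending a partial map `J → K` by `⊤`. -/
def topExtend {J K : Type u} (g : J → Option K) (x : WithTop J) : WithTop K :=
  Option.bind x g

theorem topExtend_eq_top {J K : Type u} {g : J → Option K} {x : J} (h : g x = none) :
    topExtend g x = ⊤ := h

theorem topExtend_eq_coe {J K : Type u} {g : J → Option K} {x : J} {a : K} (h : g x = some a) :
    topExtend g x = a := h

theorem IsChainMap.monotone_topExtend {J K : Type u} [LinearOrder J] [LinearOrder K]
    {g : J → Option K} (hg : IsChainMap g) : Monotone (topExtend g) := by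
  intro x y hxy
  induction y using WithTop.recTopCoe with
  | top => exact le_top
  | coe y =>
    induction x using WithTop.recTopCoe with
    | top => exact absurd hxy (by simp)
    | coe x =>
      rcases hy : g y with _ | b
      · exact topExtend_eq_top hy ▸ le_top
      · obtain ⟨a, ha⟩ := hg.total ⟨b⟩ x
        rw [topExtend_eq_coe ha, topExtend_eq_coe hy]
        exact WithTop.coe_le_coe.2 (hg.monotone x y a b (WithTop.coe_le_coe.1 hxy) ha hy)

theorem IsChainMap.surjective_topExtend {J K : Type u} [LinearOrder J] [LinearOrder K]
    {g : J → Option K} (hg : IsChainMap g) : Function.Surjective (topExtend g) := by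
  intro y
  induction y using WithTop.recTopCoe with
  | top => exact ⟨⊤, rfl⟩
  | coe b =>
    obtain ⟨m, n, -, hn, hmn⟩ := hg.map_max ⟨b⟩
    obtain ⟨x, -, hx⟩ := hg.image_lower Set.univ isLowerSet_univ (hn b) ⟨m, trivial, hmn⟩
    exact ⟨(x : WithTop J), hx⟩

theorem IsChainMap.isTop_of_topExtend {J K : Type u} [LinearOrder J] [LinearOrder K]
    {g : J → Option K} (hg : IsChainMap g) (hK : Nontrivial (WithTop K)) (x : WithTop J)
    (hx : IsTop (topExtend g x)) : IsTop x := by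
  rw [isTop_iff_eq_top] at hx ⊢
  induction x using WithTop.recTopCoe with
  | top => rfl
  | coe x =>
    obtain ⟨k, hk⟩ := exists_ne (⊤ : WithTop K)
    obtain ⟨k, rfl⟩ := WithTop.ne_top_iff_exists.1 hk
    obtain ⟨a, ha⟩ := hg.total ⟨k⟩ x
    rw [topExtend_eq_coe ha] at hx
    exact absurd hx WithTop.coe_ne_top

/-- The finite nonempty chain `J ∪ {⊤}`. -/
noncomputable def HallPair.topChain (P : HallPair.{u}) : NonemptyFinLinOrd.{u} :=
  letI := Fintype.ofFinite (WithTop P.J)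
  NonemptyFinLinOrd.of (WithTop P.J)

/-- The multiset of chains obtained from a hall forest by forgetting the trees and adding a
maximum to each chain. -/
noncomputable def HF.topChains (X : HF.{u}) : MC.{u} where
  ι := X.ι
  chain i := (X.pair i).topChain

noncomputable def HF.Hom.topChains {X Y : HF.{u}} (f : HF.Hom X Y) :
    MC.Hom X.topChains Y.topChains where
  idx := f.idx
  map i := ⟨topExtend (f.chain i), (f.isChainMap i).monotone_topExtend⟩
  surj i := (f.isChainMap i).surjective_topExtend

theorem HF.Hom.topProp_topChains {X Y : HF.{u}} (f : HF.Hom X Y) :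
    MC.topProp f.topChains :=
  (MC.topProp_iff _).2 fun i hi x hx => (f.isChainMap i).isTop_of_topExtend hi x hx

noncomputable def HF.topChainsFunctor : HF.trivialTrees.{u}.FullSubcategory ⥤ MCTop.{u} where
  obj X := ⟨X.obj.topChains⟩
  map f := ⟨f.hom.topChains, f.hom.topProp_topChains⟩
  map_id _ := WideSubcategory.hom_ext _ <| MC.Hom.ext rfl <| heq_of_eq <| funext fun _ =>
    OrderHom.ext _ _ <| funext fun x => Option.bind_fun_some x
  map_comp _ _ := WideSubcategory.hom_ext _ <| MC.Hom.ext rfl <| heq_of_eq <| funext fun _ =>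
    OrderHom.ext _ _ <| funext fun x => (Option.bind_assoc x _ _).symm

theorem HF.Hom.topChains_injective {X Y : HF.{u}} (hY : HF.trivialTrees Y) :
    Function.Injective (HF.Hom.topChains : HF.Hom X Y → _) := by
  rintro ⟨i₁, t₁, c₁, _, _⟩ ⟨i₂, t₂, c₂, _, _⟩ h
  obtain ⟨h₁, h₂⟩ := MC.Hom.mk.inj h
  obtain rfl : i₁ = i₂ := h₁
  have h₃ := eq_of_heq h₂
  refine HF.Hom.ext rfl (heq_of_eq ?_) (heq_of_eq ?_)
  · funext i x
    exact (hY _).elim _ _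
  · funext i x
    exact congrArg (fun m => m.toFun (x : WithTop _)) (congrFun h₃ i)

theorem isChainMap_of_surjective {J K : Type u} [LinearOrder J] [LinearOrder K] [Finite J]
    (h : WithTop J → WithTop K) (hm : Monotone h) (hs : Function.Surjective h)
    (ht : Nontrivial (WithTop K) → ∀ x, IsTop (h x) → IsTop x) :
    IsChainMap (fun x : J => h x) := by
  have ht' : Nonempty K → ∀ x : J, ∃ a : K, h x = a := by
    rintro ⟨k⟩ x
    refine (WithTop.ne_top_iff_exists.1 fun hx => ?_).imp fun _ => Eq.symm
    have := ht ⟨k, ⊤, WithTop.coe_ne_top⟩ x (hx ▸ isTop_top)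
    exact WithTop.coe_ne_top (isTop_iff_eq_top.1 this)
  have hsurj : ∀ k : K, ∃ x : J, h x = k := by
    intro k
    obtain ⟨x, hx⟩ := hs k
    induction x using WithTop.recTopCoe with
    | coe x => exact ⟨x, hx⟩
    | top =>
      obtain ⟨y, hy⟩ := hs ⊤
      have := hx ▸ hy ▸ hm (le_top : y ≤ ⊤)
      exact absurd (top_unique this) WithTop.coe_ne_top
  refine ⟨ht', fun x y a b hxy ha hb => ?_, fun A hA b a hab hb => ?_, ?_⟩
  · have ha' : h x = a := ha
    have hb' : h y = b := hb
    have := hm (WithTop.coe_le_coe.2 hxy)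
    rw [ha', hb'] at this
    exact WithTop.coe_le_coe.1 this
  · obtain ⟨x, hx, hxb⟩ := hb
    obtain ⟨y, hy⟩ := hsurj a
    rcases le_total y x with hyx | hxy
    · exact ⟨y, hA hyx hx, hy⟩
    · refine ⟨x, hx, hxb.trans ?_⟩
      have := hm (WithTop.coe_le_coe.2 hxy)
      have h₂ : (b : WithTop K) ≤ a := by
        have e : h x = b := hxb
        rwa [e, hy] at this
      exact congrArg _ (le_antisymm (WithTop.coe_le_coe.1 h₂) hab)
  · rintro ⟨k⟩
    obtain ⟨x₀, -⟩ := hsurj k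
    have : Nonempty J := ⟨x₀⟩
    obtain ⟨m, hmax⟩ := Finite.exists_max (_root_.id : J → J)
    obtain ⟨n, hn⟩ := ht' ⟨k⟩ m
    refine ⟨m, n, hmax, fun b => ?_, hn⟩
    obtain ⟨x, hx⟩ := hsurj b
    have := hm (WithTop.coe_le_coe.2 (hmax x))
    exact WithTop.coe_le_coe.1 (hx ▸ hn ▸ this)

theorem HF.Hom.exists_topChains_eq {X Y : HF.{u}} (hY : HF.trivialTrees Y)
    (h : MC.Hom X.topChains Y.topChains) (hh : MC.topProp h) :
    ∃ f : HF.Hom X Y, f.topChains = h := by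
  rw [MC.topProp_iff] at hh
  let c (i : X.ι) (x : (X.pair i).J) : Option (Y.pair (h.idx i)).J :=
    h.map i ((x : WithTop (X.pair i).J) : (X.pair i).topChain)
  have hc (i) : IsChainMap (c i) :=
    isChainMap_of_surjective (h.map i) (h.map i).monotone (h.surj i) (hh i)
  refine ⟨⟨h.idx, fun i _ => (Y.pair (h.idx i)).exists_min.choose, c, fun i => ⟨?_, ?_⟩, hc⟩, ?_⟩
  · exact fun _ _ _ => le_rfl
  · rintro A - b a hab ⟨x, hx, rfl⟩
    exact ⟨x, hx, (hY _).elim _ _⟩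
  · refine MC.Hom.ext rfl <| heq_of_eq <| funext fun i => OrderHom.ext _ _ <| funext fun x => ?_
    change topExtend (c i) x = h.map i x
    induction x using WithTop.recTopCoe with
    | coe x => rfl
    | top =>
      obtain ⟨y, hy⟩ := h.surj i (⊤ : WithTop (Y.pair (h.idx i)).J)
      symm
      exact top_unique (α := WithTop (Y.pair (h.idx i)).J)
        (hy.ge.trans ((h.map i).monotone (le_top (α := WithTop (X.pair i).J))))

instance : HF.topChainsFunctor.{u}.Faithful where
  map_injective {_ Y} _ _ h := ObjectProperty.hom_ext _ <|
    HF.Hom.topChains_injective Y.property (congrArg (fun k => k.hom) h)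

instance : HF.topChainsFunctor.{u}.Full where
  map_surjective {X Y} h := by
    obtain ⟨f, hf⟩ := HF.Hom.exists_topChains_eq Y.property h.hom h.property
    exact ⟨ObjectProperty.homMk f, WideSubcategory.hom_ext _ hf⟩

/-- A family of order isomorphisms is an isomorphism of multisets of chains. -/
def MCTop.isoOfOrderIso {ι : Type u} [Finite ι] {C D : ι → NonemptyFinLinOrd.{u}}
    (e : ∀ i, C i ≃o D i) : (⟨⟨ι, C⟩⟩ : MCTop.{u}) ≅ ⟨⟨ι, D⟩⟩ where
  hom := ⟨⟨id, fun i => (e i : C i →o D i), fun i => (e i).surjective⟩,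
    (MC.topProp_iff _).2 fun i _ _ hx y => (e i).le_iff_le.1 (hx (e i y))⟩
  inv := ⟨⟨id, fun i => ((e i).symm : D i →o C i), fun i => (e i).symm.surjective⟩,
    (MC.topProp_iff _).2 fun i _ _ hx y => (e i).symm.le_iff_le.1 (hx ((e i).symm y))⟩
  hom_inv_id := WideSubcategory.hom_ext _ <| MC.Hom.ext rfl <| heq_of_eq <| funext fun i =>
    OrderHom.ext _ _ <| funext fun x => (e i).symm_apply_apply x
  inv_hom_id := WideSubcategory.hom_ext _ <| MC.Hom.ext rfl <| heq_of_eq <| funext fun i =>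
    OrderHom.ext _ _ <| funext fun x => (e i).apply_symm_apply x

/-- The pair of the one-element tree and the chain `C` without its maximum. -/
def NonemptyFinLinOrd.hallPair (C : NonemptyFinLinOrd.{u}) : HallPair.{u} where
  T := PUnit
  exists_min := ⟨⟨⟩, fun _ => le_rfl⟩
  downset_chain _ := Set.subsingleton_of_subsingleton.isChain
  J := {x : C // x ≠ ⊤}

noncomputable def NonemptyFinLinOrd.topChainHallPairIso (C : NonemptyFinLinOrd.{u}) :
    C.hallPair.topChain ≃o C :=
  haveI : DecidableEq C := Classical.decEq _
  (WithTop.subtypeOrderIso : WithTop {x : C // x ≠ ⊤} ≃o C)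

instance : HF.topChainsFunctor.{u}.EssSurj where
  mem_essImage C := ⟨⟨⟨C.obj.ι, fun i => (C.obj.chain i).hallPair⟩,
    fun _ => inferInstanceAs (Subsingleton PUnit)⟩,
    ⟨MCTop.isoOfOrderIso fun i => (C.obj.chain i).topChainHallPairIso⟩⟩

instance : HF.topChainsFunctor.{u}.IsEquivalence where

namespace MTLAlgebra

variable {A : Type u} [MTLAlgebra A]

theorem le_one (x : A) : x ≤ 1 := one_eq_top (A := A) ▸ le_top

theorem mul_le_mul_right_of_le {x y : A} (h : x ≤ y) (z : A) : x * z ≤ y * z :=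
  (residuation x z _).2 (h.trans ((residuation y z _).1 le_rfl))

theorem mul_mono {x y z w : A} (h : x ≤ y) (h' : z ≤ w) : x * z ≤ y * w :=
  (mul_le_mul_right_of_le h z).trans
    (by simpa only [mul_comm] using mul_le_mul_right_of_le h' y)

theorem mul_le_left (x y : A) : x * y ≤ x := by
  simpa using mul_mono (le_refl x) (le_one y)

theorem mul_le_right (x y : A) : x * y ≤ y := mul_comm y x ▸ mul_le_left y x

protected theorem bot_mul (x : A) : ⊥ * x = ⊥ := le_bot_iff.1 (mul_le_left _ _)

protected theorem mul_bot (x : A) : x * ⊥ = ⊥ := le_bot_iff.1 (mul_le_right _ _)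

theorem himp_eq_one_iff {x y : A} : x ⇨ y = 1 ↔ x ≤ y := by
  have h := residuation 1 x y
  rw [one_mul] at h
  exact ⟨fun e => h.2 e.ge, fun e => le_antisymm (le_one _) (h.1 e)⟩

theorem one_himp (x : A) : (1 : A) ⇨ x = x :=
  le_antisymm (by simpa using (residuation ((1 : A) ⇨ x) 1 x).2 le_rfl)
    ((residuation _ _ _).1 (by simp))

protected theorem bot_himp (x : A) : ⊥ ⇨ x = 1 := himp_eq_one_iff.2 bot_le

protected theorem mul_sup (x y z : A) : x * (y ⊔ z) = x * y ⊔ x * z := by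
  apply le_antisymm
  · rw [mul_comm, residuation]
    refine sup_le ?_ ?_ <;> rw [← residuation, mul_comm]
    · exact le_sup_left
    · exact le_sup_right
  · exact sup_le (mul_mono le_rfl le_sup_left) (mul_mono le_rfl le_sup_right)

/-- A bijection which preserves and reflects the order and preserves products is a homomorphism. -/
theorem map_himp_of_orderIso {B : Type u} [MTLAlgebra B] (e : A ≃o B)
    (h : ∀ x y, e (x * y) = e x * e y) (x y : A) : e (x ⇨ y) = e x ⇨ e y := by
  refine eq_of_forall_le_iff fun z => ?_
  obtain ⟨z, rfl⟩ := e.surjective z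
  rw [e.le_iff_le, ← residuation, ← residuation, ← h, e.le_iff_le]

def homOfOrderIso {B : Type u} [MTLAlgebra B] (e : A ≃o B)
    (h : ∀ x y, e (x * y) = e x * e y) : MTLHom A B where
  toFun := e
  map_mul := h
  map_himp := map_himp_of_orderIso e h
  map_inf := e.map_inf
  map_sup := e.map_sup
  map_bot := e.map_bot
  map_one := by rw [one_eq_top, e.map_top, one_eq_top]

instance {ι : Type u} (A : ι → Type u) [∀ i, MTLAlgebra (A i)] : MTLAlgebra (∀ i, A i) where
  one_eq_top := funext fun _ => one_eq_top
  residuation x y z := by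
    simp only [Pi.le_def]
    exact forall_congr' fun i => residuation _ _ _
  prelinear x y := funext fun _ => prelinear _ _

theorem eval_pi {ι : Type u} (A : ι → Type u) [∀ i, MTLAlgebra (A i)] (t : MTLTerm)
    (v : ℕ → ∀ i, A i) (i : ι) : t.eval v i = t.eval fun n => v n i := by
  induction t with
  | var n => rfl
  | zero => rfl
  | one => rfl
  | mul s t hs ht => exact congrArg₂ (· * ·) hs ht
  | imp s t hs ht => exact congrArg₂ (· ⇨ ·) hs ht
  | inf s t hs ht => exact congrArg₂ (· ⊓ ·) hs ht
  | sup s t hs ht => exact congrArg₂ (· ⊔ ·) hs ht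

end MTLAlgebra

theorem isDPAlgebra_pi {ι : Type u} (A : ι → Type u) [∀ i, MTLAlgebra (A i)]
    (hA : ∀ i, IsDPChain (A i)) : IsDPAlgebra (∀ i, A i) := by
  intro s t h v
  funext i
  rw [MTLAlgebra.eval_pi, MTLAlgebra.eval_pi]
  exact h (A i) (hA i) _

namespace IsDPChain

open MTLAlgebra

variable {B : Type u} [MTLAlgebra B]

theorem eq_one_or (hB : IsDPChain B) (x : B) : x = 1 ∨ x * x = ⊥ := by
  rcases (le_one x).eq_or_lt with h | h
  · exact .inl h
  · exact .inr (hB.mul_eq_bot x x h h)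

end IsDPChain

namespace IsDPAlgebra

open MTLAlgebra MTLTerm

variable {A : Type u} [MTLAlgebra A]

/-- Identities in two variables transfer from drastic product chains. -/
theorem transfer (hA : IsDPAlgebra A) (s t : MTLTerm)
    (h : ∀ (B : Type u) [MTLAlgebra B], IsDPChain B → SatisfiesEq B s t) (x y : A) :
    s.eval (fun n => if n = 0 then x else y) = t.eval (fun n => if n = 0 then x else y) :=
  hA s t h _

theorem sq_idem (hA : IsDPAlgebra A) (x : A) : x * x * (x * x) = x * x :=
  hA.transfer (.mul (.mul (.var 0) (.var 0)) (.mul (.var 0) (.var 0)))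
    (.mul (.var 0) (.var 0)) (fun B _ hB v => by
      rcases hB.eq_one_or (v 0) with h | h <;> simp [MTLTerm.eval, h, MTLAlgebra.bot_mul]) x x

theorem not_sq_idem (hA : IsDPAlgebra A) (x : A) :
    (x * x ⇨ ⊥) * (x * x ⇨ ⊥) = x * x ⇨ ⊥ :=
  hA.transfer (.mul (.imp (.mul (.var 0) (.var 0)) .zero) (.imp (.mul (.var 0) (.var 0)) .zero))
    (.imp (.mul (.var 0) (.var 0)) .zero) (fun B _ hB v => by
      rcases hB.eq_one_or (v 0) with h | h <;> simp [MTLTerm.eval, h, MTLAlgebra.bot_mul, one_himp, MTLAlgebra.bot_himp]) x x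

theorem sup_not_sq (hA : IsDPAlgebra A) (x : A) : x ⊔ (x * x ⇨ ⊥) = 1 :=
  hA.transfer (.sup (.var 0) (.imp (.mul (.var 0) (.var 0)) .zero)) .one (fun B _ hB v => by
      rcases hB.eq_one_or (v 0) with h | h <;> simp [MTLTerm.eval, h, MTLAlgebra.bot_himp, le_one]) x x

theorem sq_mul (hA : IsDPAlgebra A) (x y : A) : x * x * y = x * x ⊓ y :=
  hA.transfer (.mul (.mul (.var 0) (.var 0)) (.var 1)) (.inf (.mul (.var 0) (.var 0)) (.var 1))
    (fun B _ hB v => by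
      rcases hB.eq_one_or (v 0) with h | h <;> simp [MTLTerm.eval, h, MTLAlgebra.bot_mul, le_one]) x y

theorem sq_himp_sup (hA : IsDPAlgebra A) (x y : A) :
    (x ⇨ y) * (x ⇨ y) ⊔ (y ⇨ x) * (y ⇨ x) = 1 :=
  hA.transfer (.sup (.mul (.imp (.var 0) (.var 1)) (.imp (.var 0) (.var 1)))
    (.mul (.imp (.var 1) (.var 0)) (.imp (.var 1) (.var 0)))) .one
    (fun B _ hB v => by
      rcases hB.total (v 0) (v 1) with h | h <;>
        simp [MTLTerm.eval, himp_eq_one_iff.2 h, le_one]) x y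

end IsDPAlgebra

/-- The minimal nonzero idempotents. -/
def IsIdemAtom {A : Type u} [MTLAlgebra A] (e : A) : Prop :=
  Minimal (fun e : A => e * e = e ∧ e ≠ ⊥) e

namespace IsIdemAtom

open MTLAlgebra

variable {A : Type u} [MTLAlgebra A] {e : A}

theorem idem (he : IsIdemAtom e) : e * e = e := he.prop.1

theorem ne_bot (he : IsIdemAtom e) : e ≠ ⊥ := he.prop.2

theorem mul_eq (he : IsIdemAtom e) (hA : IsDPAlgebra A) (x : A) : e * x = e ⊓ x := by
  have := hA.sq_mul e x
  rwa [he.idem] at this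

theorem mul_of_le (he : IsIdemAtom e) (hA : IsDPAlgebra A) {x : A} (hx : x ≤ e) : e * x = x := by
  rw [he.mul_eq hA, inf_eq_right.2 hx]

theorem le_or_mul_sq (he : IsIdemAtom e) (hA : IsDPAlgebra A) (x : A) :
    e ≤ x ∨ e * (x * x) = ⊥ := by
  by_cases h : e * (x * x) = ⊥
  · exact .inr h
  · refine .inl ((he.le_of_le ⟨?_, h⟩ (mul_le_left _ _)).trans
      ((mul_le_right _ _).trans (mul_le_left _ _)))
    rw [mul_mul_mul_comm, he.idem, hA.sq_idem]

theorem total (he : IsIdemAtom e) (hA : IsDPAlgebra A) {x y : A} (hx : x ≤ e) (hy : y ≤ e) :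
    x ≤ y ∨ y ≤ x := by
  have key : ∀ {x y : A}, x ≤ e → e ≤ x ⇨ y → x ≤ y := fun {x y} hx h => by
    rw [← residuation, he.mul_of_le hA hx] at h
    exact h
  rcases he.le_or_mul_sq hA (x ⇨ y) with h | h
  · exact .inl (key hx h)
  rcases he.le_or_mul_sq hA (y ⇨ x) with h' | h'
  · exact .inr (key hy h')
  have := congrArg (e * ·) (hA.sq_himp_sup x y)
  simp only [MTLAlgebra.mul_sup, h, h', mul_one, le_refl, sup_of_le_left] at this
  exact absurd this.symm he.ne_bot

theorem supPrime (he : IsIdemAtom e) (hA : IsDPAlgebra A) {x : A} (hx : x ≤ e) (hx' : x ≠ ⊥) :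
    SupPrime x := by
  refine ⟨fun h => hx' (isMin_iff_eq_bot.1 h), fun {a b} hab => ?_⟩
  have h : x ≤ e * a ⊔ e * b := by
    rw [← MTLAlgebra.mul_sup, he.mul_eq hA]
    exact le_inf hx hab
  rcases he.total hA (mul_le_left e a) (mul_le_left e b) with h' | h'
  · rw [sup_eq_right.2 h'] at h
    exact .inr (h.trans (mul_le_right _ _))
  · rw [sup_eq_left.2 h'] at h
    exact .inl (h.trans (mul_le_right _ _))

theorem eq_of_le (he : IsIdemAtom e) (hA : IsDPAlgebra A) {f x : A} (hf : IsIdemAtom f)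
    (hx' : x ≠ ⊥) (hx : x ≤ e) (hxf : x ≤ f) : e = f := by
  have h0 : e * f ≠ ⊥ := fun h => hx' (by
    rw [he.mul_eq hA] at h
    exact le_bot_iff.1 (h ▸ le_inf hx hxf))
  have hi : e * f * (e * f) = e * f := by rw [mul_mul_mul_comm, he.idem, hf.idem]
  exact le_antisymm ((he.le_of_le ⟨hi, h0⟩ (mul_le_left _ _)).trans (mul_le_right _ _))
    ((hf.le_of_le ⟨hi, h0⟩ (mul_le_right _ _)).trans (mul_le_left _ _))

theorem le_mul_iff (he : IsIdemAtom e) (hA : IsDPAlgebra A) {x : A} (hx : x ≤ e) (hx' : x ≠ ⊥)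
    (a b : A) : x ≤ a * b ↔ (e ≤ a ∧ x ≤ b) ∨ (e ≤ b ∧ x ≤ a) := by
  constructor
  · intro h
    have ha := h.trans (mul_le_left _ _)
    have hb := h.trans (mul_le_right _ _)
    by_contra! hne
    have hea : ¬ e ≤ a := fun h => hne.1 h hb
    have heb : ¬ e ≤ b := fun h => hne.2 h ha
    have key : ∀ y, y ≤ e → (y = e * a ∨ y = e * b) → ¬ x ≤ y * y := by
      intro y hy hy' hxy
      rcases he.le_or_mul_sq hA y with h | h
      · rcases hy' with rfl | rfl
        · exact hea (h.trans (mul_le_right _ _))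
        · exact heb (h.trans (mul_le_right _ _))
      · rw [he.mul_of_le hA ((mul_le_left _ _).trans hy)] at h
        exact hx' (le_bot_iff.1 (h ▸ hxy))
    have hx2 : x ≤ e * a * (e * b) := by
      rw [mul_mul_mul_comm, he.idem, he.mul_eq hA]
      exact le_inf hx h
    rcases he.total hA (mul_le_left e a) (mul_le_left e b) with h' | h'
    · exact key _ (mul_le_left _ _) (.inr rfl) (hx2.trans (mul_mono h' le_rfl))
    · exact key _ (mul_le_left _ _) (.inl rfl) (hx2.trans (mul_mono le_rfl h'))
  · rintro (⟨h, h'⟩ | ⟨h, h'⟩)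
    · exact he.mul_of_le hA hx ▸ mul_mono h h'
    · rw [mul_comm]
      exact he.mul_of_le hA hx ▸ mul_mono h h'

theorem exists_le [Finite A] {f : A} (hf : f * f = f) (hf' : f ≠ ⊥) : ∃ e ≤ f, IsIdemAtom e :=
  Set.Finite.exists_le_minimal (Set.toFinite {e : A | e * e = e ∧ e ≠ ⊥}) ⟨hf, hf'⟩

theorem le_of_forall [Finite A] (hA : IsDPAlgebra A) {a b : A}
    (h : ∀ e, IsIdemAtom e → ∀ x ≤ e, x ≠ ⊥ → x ≤ a → x ≤ b) : a ≤ b := by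
  by_contra hab
  have h0 : (a ⇨ b) * (a ⇨ b) ⇨ ⊥ ≠ ⊥ := fun h0 => by
    have := hA.sup_not_sq (a ⇨ b)
    rw [h0, sup_bot_eq, himp_eq_one_iff] at this
    exact hab this
  obtain ⟨e, hle, he⟩ := exists_le (hA.not_sq_idem _) h0
  have hea : e * a ≤ b := by
    by_cases h1 : e * a = ⊥
    · exact h1 ▸ bot_le
    · exact h e he _ (mul_le_left _ _) h1 (mul_le_right _ _)
  have h2 : e ≤ (a ⇨ b) * (a ⇨ b) := by
    rw [residuation] at hea
    exact he.idem ▸ mul_mono hea hea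
  rw [← residuation] at hle
  exact he.ne_bot (le_bot_iff.1 (he.idem ▸ (mul_mono le_rfl h2).trans hle))

end IsIdemAtom

/-- The lower sets of a chain, as the carrier of a drastic product chain. -/
def Downset (C : Type u) [LE C] : Type u := LowerSet C

namespace Downset

variable {C : Type u} [LinearOrder C]

noncomputable instance : LinearOrder (Downset C) := inferInstanceAs (LinearOrder (LowerSet C))

instance : BoundedOrder (Downset C) := inferInstanceAs (BoundedOrder (LowerSet C))

instance : SetLike (Downset C) C := inferInstanceAs (SetLike (LowerSet C) C)

instance [Finite C] : Finite (Downset C) :=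
  Finite.of_injective (fun s : Downset C => (s : Set C)) SetLike.coe_injective

theorem lower (s : Downset C) {x y : C} (h : y ≤ x) (hx : x ∈ s) : y ∈ s :=
  LowerSet.lower s h hx

theorem ext {s t : Downset C} (h : ∀ x, x ∈ s ↔ x ∈ t) : s = t := SetLike.ext h

@[simp] theorem mem_top (x : C) : x ∈ (⊤ : Downset C) := trivial

@[simp] theorem not_mem_bot (x : C) : x ∉ (⊥ : Downset C) := id

@[simp] theorem mem_sup {s t : Downset C} {x : C} : x ∈ s ⊔ t ↔ x ∈ s ∨ x ∈ t := by
  rcases le_total s t with h | h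
  · rw [sup_eq_right.2 h]
    exact ⟨.inr, fun hx => hx.elim (h ·) id⟩
  · rw [sup_eq_left.2 h]
    exact ⟨.inl, fun hx => hx.elim id (h ·)⟩

@[simp] theorem mem_inf {s t : Downset C} {x : C} : x ∈ s ⊓ t ↔ x ∈ s ∧ x ∈ t := by
  rcases le_total s t with h | h
  · rw [inf_eq_left.2 h]
    exact ⟨fun hx => ⟨hx, h hx⟩, And.left⟩
  · rw [inf_eq_right.2 h]
    exact ⟨fun hx => ⟨h hx, hx⟩, And.right⟩

def Iic (c : C) : Downset C := LowerSet.Iic c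

def Iio (c : C) : Downset C := LowerSet.Iio c

@[simp] theorem mem_Iic {x c : C} : x ∈ Iic c ↔ x ≤ c := Iff.rfl

@[simp] theorem mem_Iio {x c : C} : x ∈ Iio c ↔ x < c := Iff.rfl

theorem eq_bot_or_Iic [Finite C] (s : Downset C) : s = ⊥ ∨ ∃ c, s = Iic c := by
  by_cases h : (s : Set C).Nonempty
  · obtain ⟨c, hc, hmax⟩ := Set.exists_max_image (s : Set C) id (Set.toFinite _) h
    exact .inr ⟨c, ext fun x => ⟨hmax x, fun hx => s.lower hx hc⟩⟩
  · exact .inl (ext fun x => iff_of_false (fun hx => h ⟨x, hx⟩) (not_mem_bot x))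

section OrderTop

variable [OrderTop C]

theorem eq_top_iff_mem {s : Downset C} : s = ⊤ ↔ ⊤ ∈ s :=
  ⟨fun h => h ▸ mem_top _, fun h => ext fun _ => iff_of_true (s.lower le_top h) (mem_top _)⟩

theorem le_Iio_top_iff {s : Downset C} : s ≤ Iio ⊤ ↔ s ≠ ⊤ := by
  rw [Ne, eq_top_iff_mem]
  exact ⟨fun h h' => lt_irrefl _ (h h'), fun h x hx => lt_top_iff_ne_top.2 fun e => h (e ▸ hx)⟩

theorem bot_ne_top : (⊥ : Downset C) ≠ ⊤ := fun h => not_mem_bot _ (eq_top_iff_mem.1 h)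

open Classical in
/-- The drastic product. -/
noncomputable def mulAux (s t : Downset C) : Downset C :=
  if s = ⊤ then t else if t = ⊤ then s else ⊥

open Classical in
/-- The residuum of the drastic product. -/
noncomputable def himpAux (s t : Downset C) : Downset C :=
  if s ≤ t then ⊤ else if s = ⊤ then t else Iio ⊤

noncomputable instance : MTLAlgebra (Downset C) where
  mul := mulAux
  one := ⊤
  himp := himpAux
  mul_comm s t := by
    change mulAux s t = mulAux t s
    unfold mulAux
    split_ifs <;> simp_all
  mul_assoc s t r := by
    change mulAux (mulAux s t) r = mulAux s (mulAux t r)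
    unfold mulAux
    split_ifs <;> simp_all [bot_ne_top]
  one_mul s := by
    change mulAux ⊤ s = s
    simp [mulAux]
  mul_one s := by
    change mulAux s ⊤ = s
    unfold mulAux
    split_ifs <;> simp_all
  one_eq_top := rfl
  residuation s t r := by
    change mulAux s t ≤ r ↔ s ≤ himpAux t r
    unfold mulAux himpAux
    by_cases hs : s = ⊤
    · subst hs
      by_cases htr : t ≤ r
      · simp [htr]
      · by_cases ht : t = ⊤
        · simp [ht]
        · have : ¬ (⊤ : Downset C) ≤ Iio ⊤ := fun h => le_Iio_top_iff.1 h rfl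
          simp only [if_true, htr, ht, if_false, false_iff]
          exact this
    · by_cases ht : t = ⊤
      · subst ht
        by_cases htr : ⊤ ≤ r
        · simp [hs, top_le_iff.1 htr]
        · simp [hs, htr]
      · by_cases htr : t ≤ r
        · simp [hs, ht, htr]
        · simp [hs, ht, htr, le_Iio_top_iff]
  prelinear s t := by
    change himpAux s t ⊔ himpAux t s = ⊤
    unfold himpAux
    rcases le_total s t with h | h <;> simp [h]

theorem mul_def (s t : Downset C) [Decidable (s = ⊤)] [Decidable (t = ⊤)] :
    s * t = if s = ⊤ then t else if t = ⊤ then s else ⊥ := by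
  change mulAux s t = _
  unfold mulAux
  congr

theorem himp_def (s t : Downset C) [Decidable (s ≤ t)] [Decidable (s = ⊤)] :
    s ⇨ t = if s ≤ t then ⊤ else if s = ⊤ then t else Iio ⊤ := by
  change himpAux s t = _
  unfold himpAux
  congr

theorem one_def : (1 : Downset C) = ⊤ := rfl

theorem mem_mul {s t : Downset C} {x : C} :
    x ∈ s * t ↔ (s = ⊤ ∧ x ∈ t) ∨ (t = ⊤ ∧ x ∈ s) := by
  classical
  rw [mul_def]
  split_ifs with h h' <;> simp_all

theorem isDPChain : IsDPChain (Downset C) where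
  total := le_total
  mul_eq_bot s t hs ht := by
    classical
    exact (mul_def s t).trans ((if_neg hs.ne).trans (if_neg ht.ne))
  mul_eq_inf s t h := by
    classical
    rw [mul_def]
    by_cases hs : s = ⊤
    · simp [hs]
    · by_cases ht : t = ⊤
      · simp [hs, ht]
      · exact absurd ⟨lt_top_iff_ne_top.2 hs, lt_top_iff_ne_top.2 ht⟩ h

end OrderTop

end Downset

/-! ### The decomposition of a finite drastic product algebra -/

/-- The nonzero elements below `e`. -/
@[ext]
structure BelowAtom {A : Type u} [MTLAlgebra A] (e : A) : Type u where
  val : A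
  le : val ≤ e
  ne_bot : val ≠ ⊥

namespace FinDP

variable {A : FinDP.{u}}

variable (A) in
/-- The minimal nonzero idempotents of a finite drastic product algebra. -/
def Atom : Type u := {e : A.carrier // IsIdemAtom e}

instance : Finite A.Atom := Subtype.finite

noncomputable instance (e : A.Atom) : LinearOrder (BelowAtom e.1) where
  __ := PartialOrder.lift (BelowAtom.val : BelowAtom e.1 → A.carrier) fun _ _ => BelowAtom.ext
  le_total x y := e.2.total A.isDP x.le y.le
  toDecidableLE := Classical.decRel _

theorem finite_belowAtom (e : A.Atom) : Finite (BelowAtom e.1) :=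
  Finite.of_injective (BelowAtom.val : BelowAtom e.1 → A.carrier) fun _ _ => BelowAtom.ext

noncomputable instance (e : A.Atom) : Fintype (BelowAtom e.1) :=
  @Fintype.ofFinite _ (finite_belowAtom e)

instance (e : A.Atom) : Nonempty (BelowAtom e.1) := ⟨⟨e.1, le_rfl, e.2.ne_bot⟩⟩

noncomputable instance (e : A.Atom) : BoundedOrder (BelowAtom e.1) := Fintype.toBoundedOrder _

theorem Atom.val_top (e : A.Atom) : (⊤ : BelowAtom e.1).val = e.1 :=
  le_antisymm (⊤ : BelowAtom e.1).le (le_top (a := (⟨e.1, le_rfl, e.2.ne_bot⟩ : BelowAtom e.1)))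

variable (A)

/-- The elements of the component of `e` below `a`. -/
def component (a : A.carrier) (e : A.Atom) : Downset (BelowAtom e.1) where
  carrier := {x : BelowAtom e.1 | x.1 ≤ a}
  lower' := fun _ _ hyx hx => le_trans hyx hx

variable {A} in
theorem mem_component {a : A.carrier} {e : A.Atom} {x : BelowAtom e.1} :
    x ∈ A.component a e ↔ x.1 ≤ a := Iff.rfl

theorem component_le_iff {a b : A.carrier} : A.component a ≤ A.component b ↔ a ≤ b :=
  ⟨fun h => IsIdemAtom.le_of_forall A.isDP fun e he x hx hx' hxa =>
    h ⟨e, he⟩ (show (⟨x, hx, hx'⟩ : BelowAtom e) ∈ A.component a ⟨e, he⟩ from hxa),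
    fun h _ _ hx => le_trans (mem_component.1 hx) h⟩

theorem component_surjective : Function.Surjective A.component := by
  classical
  intro s
  have := Fintype.ofFinite A.carrier
  let S : Finset A.carrier := {y | ∃ e : A.Atom, ∃ z : BelowAtom e.1, z ∈ s e ∧ z.1 = y}
  refine ⟨S.sup id, funext fun e => Downset.ext fun x => ?_⟩
  rw [mem_component, (e.2.supPrime A.isDP x.le x.ne_bot).le_finset_sup]
  constructor
  · rintro ⟨y, hy, hxy⟩
    obtain ⟨f, z, hz, rfl⟩ := (Finset.mem_filter.1 hy).2
    obtain rfl : e = f :=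
      Subtype.ext (e.2.eq_of_le A.isDP f.2 x.ne_bot x.le (le_trans hxy z.le))
    exact (s e).lower hxy hz
  · exact fun hx => ⟨x.1, Finset.mem_filter.2 ⟨Finset.mem_univ _, e, x, hx, rfl⟩, le_rfl⟩

theorem component_mul (a b : A.carrier) :
    A.component (a * b) = A.component a * A.component b := by
  refine funext fun e => Downset.ext fun x => ?_
  rw [Pi.mul_apply, Downset.mem_mul, Downset.eq_top_iff_mem, Downset.eq_top_iff_mem]
  simp only [mem_component, Atom.val_top]
  exact e.2.le_mul_iff A.isDP x.le x.ne_bot a b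

/-- A finite drastic product algebra is the product of its components. -/
noncomputable def componentIso : A.carrier ≃o ∀ e : A.Atom, Downset (BelowAtom e.1) where
  toEquiv := Equiv.ofBijective A.component
    ⟨fun _ _ h => le_antisymm (A.component_le_iff.1 h.le) (A.component_le_iff.1 h.ge),
      A.component_surjective⟩
  map_rel_iff' := A.component_le_iff

theorem componentIso_mul (a b : A.carrier) :
    A.componentIso (a * b) = A.componentIso a * A.componentIso b :=
  A.component_mul a b

/-- An order isomorphism preserving products is an isomorphism. -/
def isoOfOrderIso {A B : FinDP.{u}} (e : A.carrier ≃o B.carrier)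
    (h : ∀ x y, e (x * y) = e x * e y) : A ≅ B where
  hom := MTLAlgebra.homOfOrderIso e h
  inv := MTLAlgebra.homOfOrderIso e.symm fun x y => by
    rw [e.symm_apply_eq, h, e.apply_symm_apply, e.apply_symm_apply]
  hom_inv_id := MTLHom.ext (funext e.symm_apply_apply)
  inv_hom_id := MTLHom.ext (funext e.apply_symm_apply)

end FinDP

namespace Downset

variable {C D : Type u} [LinearOrder C] [LinearOrder D]

/-- The inverse image of a lower set. -/
def comap (h : C →o D) (s : Downset D) : Downset C where
  carrier := {x | h x ∈ s}
  lower' := fun _ _ hyx hx => s.lower (h.monotone hyx) hx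

@[simp] theorem mem_comap {h : C →o D} {s : Downset D} {x : C} : x ∈ comap h s ↔ h x ∈ s := Iff.rfl

theorem comap_le_comap {h : C →o D} (hs : Function.Surjective h) {s t : Downset D} :
    comap h s ≤ comap h t ↔ s ≤ t :=
  ⟨fun H y hy => by
    obtain ⟨x, rfl⟩ := hs y
    exact H (show x ∈ comap h s from hy), fun H _ hx => H hx⟩

theorem comap_inf (h : C →o D) (s t : Downset D) : comap h (s ⊓ t) = comap h s ⊓ comap h t :=
  ext fun x => by simp only [mem_comap, mem_inf]

theorem comap_sup (h : C →o D) (s t : Downset D) : comap h (s ⊔ t) = comap h s ⊔ comap h t :=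
  ext fun x => by simp only [mem_comap, mem_sup]

variable [OrderTop C] [OrderTop D]

theorem comap_eq_top {h : C →o D} (hs : Function.Surjective h) {s : Downset D} :
    comap h s = ⊤ ↔ s = ⊤ := by
  rw [← top_le_iff, ← top_le_iff, ← comap_le_comap hs]
  exact Iff.rfl

theorem comap_mul {h : C →o D} (hs : Function.Surjective h) (s t : Downset D) :
    comap h (s * t) = comap h s * comap h t :=
  ext fun x => by simp only [mem_comap, mem_mul, comap_eq_top hs]

theorem comap_himp {h : C →o D} (hs : Function.Surjective h)
    (ht : Nontrivial D → ∀ x, IsTop (h x) → IsTop x) (s t : Downset D) :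
    comap h (s ⇨ t) = comap h s ⇨ comap h t := by
  classical
  rw [himp_def, himp_def]
  simp only [comap_le_comap hs, comap_eq_top hs]
  split_ifs with h₁ h₂
  · rfl
  · rfl
  · refine ext fun x => ?_
    have hD : Nontrivial D := by
      by_contra hD
      rw [not_nontrivial_iff_subsingleton] at hD
      obtain ⟨y, hy, -⟩ := Set.not_subset.1 h₁
      exact h₂ (eq_top_iff_mem.2 (Subsingleton.elim y ⊤ ▸ hy))
    simp only [mem_comap, mem_Iio, lt_top_iff_ne_top, Ne, not_iff_not]
    constructor
    · exact fun hx => isTop_iff_eq_top.1 (ht hD x (isTop_iff_eq_top.2 hx))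
    · rintro rfl
      obtain ⟨x, hx⟩ := hs ⊤
      exact top_unique (hx ▸ h.monotone le_top)

theorem Iio_top_himp_bot (h : Iio (⊤ : D) ≠ ⊥) : Iio (⊤ : D) ⇨ ⊥ = Iio ⊤ := by
  classical
  rw [himp_def, if_neg (fun h' => h (le_bot_iff.1 h')), if_neg]
  exact fun h' => le_Iio_top_iff.1 le_rfl h'

theorem eq_Iio_top_of_himp_bot {s : Downset D} (h : s ⇨ ⊥ = s) : s = Iio ⊤ := by
  classical
  rw [himp_def] at h
  split_ifs at h with h₁ h₂
  · exact absurd (le_bot_iff.1 h₁ ▸ h).symm bot_ne_top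
  · exact absurd (h.trans h₂) bot_ne_top
  · exact h.symm

end Downset

namespace MTLHom

open Downset

theorem map_mono {A B : Type u} [MTLAlgebra A] [MTLAlgebra B] (f : MTLHom A B) {x y : A}
    (h : x ≤ y) : f.toFun x ≤ f.toFun y := by
  rw [← inf_eq_left, ← f.map_inf, inf_eq_left.2 h]

section Chain

variable {C D : Type u} [LinearOrder C] [LinearOrder D] [OrderTop C] [OrderTop D]

theorem map_eq_top_iff (f : MTLHom (Downset D) (Downset C)) {s : Downset D} :
    f.toFun s = ⊤ ↔ s = ⊤ := by
  refine ⟨fun h => ?_, fun h => h ▸ f.map_one⟩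
  by_contra hs
  have hs' : s * s = ⊥ := isDPChain.mul_eq_bot s s (lt_top_iff_ne_top.2 hs) (lt_top_iff_ne_top.2 hs)
  have := f.map_mul s s
  rw [hs', f.map_bot, h, ← one_def, mul_one] at this
  exact bot_ne_top this

theorem map_le_map_iff (f : MTLHom (Downset D) (Downset C)) {s t : Downset D} :
    f.toFun s ≤ f.toFun t ↔ s ≤ t := by
  rw [← MTLAlgebra.himp_eq_one_iff, ← f.map_himp, one_def, f.map_eq_top_iff, ← one_def,
    MTLAlgebra.himp_eq_one_iff]

/-- Homomorphisms between finite drastic product chains are dual to surjections of chains. -/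
theorem exists_eq_comap [Finite C] [Finite D] (f : MTLHom (Downset D) (Downset C)) :
    ∃ h : C →o D, Function.Surjective h ∧ (Nontrivial D → ∀ x, IsTop (h x) → IsTop x) ∧
      ∀ s, f.toFun s = comap h s := by
  have hex : ∀ c : C, ∃ d : D, c ∈ f.toFun (Iic d) ∧ ∀ d', c ∈ f.toFun (Iic d') → d ≤ d' := by
    intro c
    refine Set.exists_min_image {d : D | c ∈ f.toFun (Iic d)} id (Set.toFinite _) ⟨⊤, ?_⟩
    have : f.toFun (Iic ⊤) = ⊤ := f.map_eq_top_iff.2 (eq_top_iff_mem.2 (mem_Iic.2 le_rfl))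
    rw [Set.mem_ofPred_eq, this]
    exact mem_top c
  choose h hmem hmin using hex
  have hiff : ∀ c d, c ∈ f.toFun (Iic d) ↔ h c ≤ d := fun c d =>
    ⟨hmin c d, fun hcd => f.map_mono (fun _ hx => le_trans hx hcd) (hmem c)⟩
  let H : C →o D := ⟨h, fun c c' hcc => hmin c _ ((f.toFun _).lower hcc (hmem c'))⟩
  have hH : ∀ s, f.toFun s = comap H s := by
    intro s
    rcases s.eq_bot_or_Iic with rfl | ⟨d, rfl⟩
    · exact f.map_bot
    · exact ext fun c => hiff c d
  have hsurj : Function.Surjective H := by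
    intro d
    have hlt : ¬ f.toFun (Iic d) ≤ f.toFun (Iio d) := fun hle =>
      lt_irrefl d (f.map_le_map_iff.1 hle (show d ∈ Iic d from le_rfl))
    obtain ⟨c, hc, hc'⟩ := Set.not_subset.1 hlt
    rw [hH] at hc hc'
    exact ⟨c, le_antisymm hc (not_lt.1 hc')⟩
  refine ⟨H, hsurj, fun hD x hx => ?_, hH⟩
  obtain ⟨y, hy⟩ := exists_ne (⊤ : D)
  have hne : Iio (⊤ : D) ≠ ⊥ := fun h0 => by
    have : y ∈ Iio (⊤ : D) := lt_top_iff_ne_top.2 hy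
    rw [h0] at this
    exact not_mem_bot y this
  have hco : f.toFun (Iio ⊤) = Iio ⊤ := eq_Iio_top_of_himp_bot (by
    conv_rhs => rw [← Iio_top_himp_bot hne, f.map_himp, f.map_bot])
  rw [isTop_iff_eq_top] at hx ⊢
  by_contra hx'
  have hmemx : x ∈ f.toFun (Iio ⊤) := hco ▸ lt_top_iff_ne_top.2 hx'
  rw [hH] at hmemx
  exact ne_of_lt hmemx hx

end Chain

/-- A homomorphism from a finite product of drastic product chains to a drastic product chain
factors through a projection. -/
theorem exists_factor {ι : Type u} [Finite ι] {D : ι → Type u} {C : Type u} [LinearOrder C]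
    [OrderTop C] [∀ j, LinearOrder (D j)] [∀ j, OrderTop (D j)]
    (f : MTLHom (∀ j, Downset (D j)) (Downset C)) :
    ∃ j, ∃ g : MTLHom (Downset (D j)) (Downset C), ∀ s, f.toFun s = g.toFun (s j) := by
  classical
  have := Fintype.ofFinite ι
  let e (j : ι) (t : Downset (D j)) : ∀ j, Downset (D j) := Function.update ⊥ j t
  have he : ∀ j s, s * e j ⊤ = e j (s j) := by
    intro j s
    funext k
    rcases eq_or_ne k j with rfl | hk
    · simp only [e, Pi.mul_apply, Function.update_self]
      exact mul_one (s k)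
    · simpa [e, hk] using MTLAlgebra.mul_bot (s k)
  obtain ⟨j, hj⟩ : ∃ j, f.toFun (e j ⊤) = ⊤ := by
    by_contra! hne
    have h0 : ∀ j, f.toFun (e j ⊤) = ⊥ := by
      intro j
      have h := f.map_mul (e j ⊤) (e j ⊤)
      rw [he, show e j ⊤ j = ⊤ from Function.update_self .., isDPChain.mul_eq_bot _ _ (lt_top_iff_ne_top.2 (hne j))
        (lt_top_iff_ne_top.2 (hne j))] at h
      exact h
    have hsup : ∀ S : Finset ι, f.toFun (S.sup fun j => e j ⊤) = ⊥ := by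
      intro S
      induction S using Finset.induction_on with
      | empty => exact f.map_bot
      | insert j S _ ih =>
        rw [Finset.sup_insert]
        exact (f.map_sup _ _).trans (by rw [h0, ih, sup_idem])
    have htop : (Finset.univ.sup fun j => e j ⊤) = (1 : ∀ j, Downset (D j)) := by
      refine le_antisymm (MTLAlgebra.le_one _) fun k => ?_
      have := Finset.le_sup (f := fun j => e j ⊤) (Finset.mem_univ k) k
      rwa [show e k ⊤ k = ⊤ from Function.update_self ..] at this
    have := hsup Finset.univ
    rw [htop, f.map_one] at this
    exact bot_ne_top this.symm
  have key : ∀ s t : ∀ j, Downset (D j), s j = t j → f.toFun s = f.toFun t := by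
    have hs : ∀ s, f.toFun s = f.toFun (e j (s j)) := fun s => by
      rw [← he, f.map_mul, hj, ← one_def, mul_one]
    intro s t h
    rw [hs s, hs t, h]
  refine ⟨j, ⟨fun t => f.toFun (e j t), fun s t => ?_, fun s t => ?_, fun s t => ?_,
    fun s t => ?_, ?_, ?_⟩, fun s => key _ _ (by simp [e])⟩
  · exact (key _ _ (by simp [e])).trans (f.map_mul _ _)
  · exact (key _ (e j s ⇨ e j t) (by simp [e])).trans (f.map_himp _ _)
  · exact (key _ _ (by simp [e])).trans (f.map_inf _ _)
  · exact (key _ _ (by simp [e])).trans (f.map_sup _ _)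
  · exact (key _ _ (by simp [e])).trans f.map_bot
  · exact (key _ _ (by simp [e])).trans f.map_one

end MTLHom

/-- The product of the drastic product chains of lower sets of the members of `C`. -/
noncomputable def MC.algebra (C : MC.{u}) : FinDP.{u} where
  carrier := ∀ i, Downset (C.chain i)
  isDP := isDPAlgebra_pi _ fun _ => Downset.isDPChain

noncomputable def MC.Hom.pullback {C D : MC.{u}} (f : MC.Hom C D) (hf : MC.topProp f) :
    D.algebra ⟶ C.algebra where
  toFun s i := Downset.comap (f.map i) (s (f.idx i))
  map_mul _ _ := funext fun i => Downset.comap_mul (f.surj i) _ _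
  map_himp _ _ := funext fun i => Downset.comap_himp (f.surj i) ((MC.topProp_iff f).1 hf i) _ _
  map_inf _ _ := funext fun _ => Downset.comap_inf _ _ _
  map_sup _ _ := funext fun _ => Downset.comap_sup _ _ _
  map_bot := rfl
  map_one := rfl

noncomputable def MCTop.algebraFunctor : MCTop.{u}ᵒᵖ ⥤ FinDP.{u} where
  obj C := C.unop.obj.algebra
  map f := f.unop.hom.pullback f.unop.property
  map_id _ := rfl
  map_comp _ _ := rfl

theorem MC.Hom.ext_of_pullback {C D : MC.{u}} {f g : MC.Hom C D} (hf : MC.topProp f)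
    (hg : MC.topProp g) (h : f.pullback hf = g.pullback hg) : f = g := by
  classical
  have h' : ∀ (s : ∀ j, Downset (D.chain j)) i x,
      f.map i x ∈ s (f.idx i) ↔ g.map i x ∈ s (g.idx i) := fun s i x => by
    have := congrFun (congrFun (congrArg MTLHom.toFun h) s) i
    exact (SetLike.ext_iff.1 this) x
  have hidx : f.idx = g.idx := funext fun i => by
    by_contra hne
    have := (h' (Function.update ⊥ (f.idx i) ⊤) i ⊤).1 (by simp)
    rw [Function.update_of_ne (Ne.symm hne)] at this
    exact Downset.not_mem_bot _ this
  obtain ⟨i₁, m₁, s₁⟩ := f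
  obtain ⟨i₂, m₂, s₂⟩ := g
  obtain rfl : i₁ = i₂ := hidx
  refine MC.Hom.ext rfl (heq_of_eq (funext fun i => OrderHom.ext _ _ (funext fun x => ?_)))
  refine eq_of_forall_ge_iff fun c => ?_
  have := h' (Function.update ⊥ (i₁ i) (Downset.Iic c)) i x
  simpa using this

theorem MC.Hom.exists_pullback_eq {C D : MC.{u}} (φ : D.algebra ⟶ C.algebra) :
    ∃ (f : MC.Hom C D) (hf : MC.topProp f), f.pullback hf = φ := by
  have hφ : ∀ i, ∃ (j : D.ι) (h : C.chain i →o D.chain j), Function.Surjective h ∧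
      (Nontrivial (D.chain j) → ∀ x, IsTop (h x) → IsTop x) ∧
      ∀ s, φ.toFun s i = Downset.comap h (s j) := by
    intro i
    let ev : MTLHom (∀ j, Downset (D.chain j)) (Downset (C.chain i)) :=
      { toFun := fun s => φ.toFun s i
        map_mul := fun s t => congrFun (φ.map_mul s t) i
        map_himp := fun s t => congrFun (φ.map_himp s t) i
        map_inf := fun s t => congrFun (φ.map_inf s t) i
        map_sup := fun s t => congrFun (φ.map_sup s t) i
        map_bot := congrFun φ.map_bot i
        map_one := congrFun φ.map_one i }
    obtain ⟨j, g, hg⟩ := ev.exists_factor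
    obtain ⟨h, hs, ht, hh⟩ := g.exists_eq_comap
    exact ⟨j, h, hs, ht, fun s => (hg s).trans (hh (s j))⟩
  choose j h hs ht hh using hφ
  exact ⟨⟨j, h, hs⟩, (MC.topProp_iff _).2 ht,
    MTLHom.ext (funext fun s => funext fun i => (hh i s).symm)⟩

instance : MCTop.algebraFunctor.{u}.Faithful where
  map_injective {_ _ f g} h := Quiver.Hom.unop_inj <| WideSubcategory.hom_ext _ <|
    MC.Hom.ext_of_pullback f.unop.property g.unop.property h

instance : MCTop.algebraFunctor.{u}.Full where
  map_surjective φ := by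
    obtain ⟨f, hf, h⟩ := MC.Hom.exists_pullback_eq φ
    exact ⟨Quiver.Hom.op ⟨f, hf⟩, h⟩

/-- The multiset of chains whose members are the components of a finite drastic product algebra. -/
noncomputable def FinDP.chains (A : FinDP.{u}) : MC.{u} where
  ι := A.Atom
  chain e := NonemptyFinLinOrd.of (BelowAtom e.1)

instance : MCTop.algebraFunctor.{u}.EssSurj where
  mem_essImage A := ⟨Opposite.op ⟨A.chains⟩,
    ⟨(FinDP.isoOfOrderIso (B := A.chains.algebra) A.componentIso A.componentIso_mul).symm⟩⟩

instance : MCTop.algebraFunctor.{u}.IsEquivalence where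

theorem theorem5p2 :
    Nonempty (MCTop.{u} ≌ HF.trivialTrees.{u}.FullSubcategory) ∧
      Nonempty (MCTop.{u}ᵒᵖ ≌ FinDP.{u}) :=
  ⟨⟨HF.topChainsFunctor.asEquivalence.symm⟩, ⟨MCTop.algebraFunctor.asEquivalence⟩⟩
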